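/- Fix integers $p_1,p_2\ge 0$, $p=p_1+p_2$, $\sigma>0$, and $\beta=(\beta_1',\beta_2')'\in\mathbb R^p$, where all $p_1$ components of $\beta_1$ are nonzero and $\beta_2=0\in\mathbb R^{p_2}$. For each sample size $n$ let $Y=X\beta+\varepsilon$, where $X=X_n=(X_1\ X_2)$ is a nonrandom $n\times p$ matrix ($X_1$ being its first $p_1$ columns) and $\varepsilon\sim N(0,\sigma^2I_n)$. Assume: 1. As $n\to\infty$, $X'X/n\to\Sigma$ with $\Sigma$ positive definite; let $\Sigma_1$ be the upper left $p_1\times p_1$ block of $\Sigma$. For every $n\ge1$ all diagonal entries of $X'X/n$ are $1$, and there are a matrix $\Delta=\Delta_n$ with $p$ columns and a number $d=d_n$ with $X'X/n+\Delta'\Delta=d\,I_p$ and $d\ge\gamma_1$, where $\gamma_1$ is the largest eigenvalue of $X'X/n$; moreover $d_n=O(1)$. 2. The tuning parameters $\lambda_n$ satisfy $\lambda_n/n\to0$ and $\lambda_n/\sqrt n\to\infty$. 3. With $\eta=\eta_n$ the largest eigenvalue of $I_{p_1}-X_1'X_1/(nd)$ (put $\eta=0$ if $p_1=0$), the iteration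 counts $k_n\in\{0,1,2,\dots\}$ satisfy $\eta_n^{k_n}\lambda_n/\sqrt n\to0$ and $k_n^2\exp\{-c(\lambda_n/\sqrt n)^2\}\to0$ for every $c>0$. Given a function $s(\cdot\,;\lambda)$ on $\mathbb R$, the OEM sequence is $\beta^{(0)}=(X'X)^{-1}X'Y$ (which exists for all large $n$) and $$\beta^{(k+1)}_j=s\bigl(u^{(k)}_j;\lambda_n/n\bigr),\quad j=1,\dots,p,\qquad u^{(k)}=\frac{X'Y}{n}+\Delta'\Delta\,\beta^{(k)}.$$ For the SCAD penalty with parameter $a>2$, $$s(u;\lambda)=\begin{cases}\operatorname{sign}(u)(|u|-\lambda)_+/d,&|u|\le(d+1)\lambda,\\ \operatorname{sign}(u)\{(a-1)|u|-a\lambda\}/\{(a-1)d-1\},&(d+1)\lambda<|u|\le ad\lambda,\\ u/d,&|u|>ad\lambda,\end{cases}$$ and for the MCP with parameter $a>1$, $$s(u;\lambda)=\begin{cases}\operatorname{sign}(u)\,a\,(|u|-\lambda)_+/(ad-1),&|u|\le ad\lambda,\\ u/d,&|u|>ad\lambda.\end{cases}$$ Then, for the OEM sequence of the SCAD with any fixed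 $a>2$, and likewise for that of the MCP with any fixed $a>1$, writing $\beta^{(k)}=(\beta_1^{(k)\prime},\beta_2^{(k)\prime})'$, as $n\to\infty$: (i) $P(\beta_2^{(k_n)}=0)\to1$; (ii) $\sqrt n\,(\beta_1^{(k_n)}-\beta_1)\to N(0,\sigma^2\Sigma_1^{-1})$ in distribution. -/

import Mathlib

open MeasureTheory ProbabilityTheory Filter Matrix
open scoped Topology

noncomputable section

/-- The normalized Gram matrix `X'X / n` of an `n`-row regression matrix `X`. -/
def normGram {n : ℕ} {ι : Type*} (X : Matrix (Fin n) ι ℝ) : Matrix ι ι ℝ :=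
  (n : ℝ)⁻¹ • (Xᵀ * X)

/-- The largest eigenvalue of a real (symmetric) matrix. -/
def maxEigenvalue {ι : Type*} [Fintype ι] [DecidableEq ι] (A : Matrix ι ι ℝ) : ℝ :=
  sSup {μ : ℝ | Module.End.HasEigenvalue (Matrix.toLin' A) μ}

/-- The closed-form one-dimensional OEM update for the SCAD penalty with parameters `a` and `lam`:
for `d ≥ 1`, the minimizer over `t` of `d t² - 2 u t + 2 P_lam(|t|)`, where
`P_lam'(θ) = lam · 1(θ ≤ lam) + (a lam - θ)₊ · 1(θ > lam) / (a - 1)`. -/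
def scadUpdate (a lam d u : ℝ) : ℝ :=
  if |u| ≤ (d + 1) * lam then Real.sign u * max (|u| - lam) 0 / d
  else if |u| ≤ a * lam * d then Real.sign u * ((a - 1) * |u| - a * lam) / ((a - 1) * d - 1)
  else u / d

/-- The closed-form one-dimensional OEM update for the MCP with parameters `a` and `lam`:
for `d ≥ 1`, the minimizer over `t` of `d t² - 2 u t + 2 P_lam(|t|)`, where
`P_lam'(θ) = (lam - θ / a) · 1(θ ≤ a lam)`. -/
def mcpUpdate (a lam d u : ℝ) : ℝ :=
  if |u| ≤ a * lam * d then Real.sign u * a * max (|u| - lam) 0 / (a * d - 1)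
  else u / d

/-- The ordinary least squares estimator `(X'X)⁻¹ X'Y`. -/
def ols {n : ℕ} {ι : Type*} [Fintype ι] [DecidableEq ι]
    (X : Matrix (Fin n) ι ℝ) (Y : Fin n → ℝ) : ι → ℝ :=
  (Xᵀ * X)⁻¹ *ᵥ (Xᵀ *ᵥ Y)

/-- The vector `u = X'Y / n + Δ'Δ b` entering the OEM update at the current iterate `b`, for the
regression matrix `X / √n` and response `Y / √n` completed by the rows of `Δ`. -/
def oemVec {n m : ℕ} {ι : Type*} [Fintype ι]
    (X : Matrix (Fin n) ι ℝ) (Δ : Matrix (Fin m) ι ℝ) (Y : Fin n → ℝ) (b : ι → ℝ) : ι → ℝ :=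
  (n : ℝ)⁻¹ • (Xᵀ *ᵥ Y) + (Δᵀ * Δ) *ᵥ b

/-- The OEM sequence started at the ordinary least squares estimator; `s` is the coordinatewise
update. -/
def oemSeq {n m : ℕ} {ι : Type*} [Fintype ι] [DecidableEq ι] (s : ℝ → ℝ)
    (X : Matrix (Fin n) ι ℝ) (Δ : Matrix (Fin m) ι ℝ) (Y : Fin n → ℝ) : ℕ → ι → ℝ
  | 0 => ols X Y
  | k + 1 => fun j => s (oemVec X Δ Y (oemSeq s X Δ Y k) j)

/-- The oracle property of a sequence of estimators `b n` of `β = (β₁, β₂)`, where the index set of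
`β₁` is `Fin p₁` and that of `β₂` is `Fin p₂`: `P(b₂ = 0) → 1`, and `√n (b₁ - β₁)` converges in
distribution to `N(0, σ² Σ₁⁻¹)`, with `Σ₁` the upper left block of `S`. -/
def OracleProperty {p₁ p₂ : ℕ} {Ω : ℕ → Type*} [∀ n, MeasurableSpace (Ω n)]
    (P : ∀ n, Measure (Ω n)) [∀ n, IsProbabilityMeasure (P n)]
    (S : Matrix (Fin p₁ ⊕ Fin p₂) (Fin p₁ ⊕ Fin p₂) ℝ) (σ : ℝ) (β : Fin p₁ ⊕ Fin p₂ → ℝ)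
    (b : ∀ n, Ω n → Fin p₁ ⊕ Fin p₂ → ℝ) : Prop :=
  Tendsto (fun n => P n {ω | ∀ j : Fin p₂, b n ω (Sum.inr j) = 0}) atTop (𝓝 1) ∧
  TendstoInDistribution
    (fun (n : ℕ) ω => √(n : ℝ) • WithLp.toLp 2
      (fun j : Fin p₁ => b n ω (Sum.inl j) - β (Sum.inl j)))
    atTop (id : EuclideanSpace ℝ (Fin p₁) → EuclideanSpace ℝ (Fin p₁)) P
    (multivariateGaussian 0 (σ ^ 2 • (S.toBlocks₁₁)⁻¹))

end

/-!
Let `w = X'ε / n`, which is of order `1 / √n`, and `G = X'X / n`. Because `λ / n` lies between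
`1 / √n` and `1` in order of magnitude, on an event of probability close to `1` the thresholding
kills the second block and leaves the first block unpenalized at every step. The errors of the OEM
iterates there are exactly the iterates of gradient descent for the least squares problem of the
oracle model, started at the error `(G⁻¹ w)₁` of ordinary least squares. They converge to the oracle
error `G₁₁⁻¹ w₁` at the rate `η = ‖1 - G₁₁ / d‖`, and `√n G₁₁⁻¹ w₁` has the limit `N(0, σ² Σ₁⁻¹)`.

The second block is killed at step `k` only if `G₂₁ x_k` is small, where `x_k` is the error of the
first block; all bounds hold uniformly in `k` and over the errors with `√n ‖w‖ ≤ R`, so no union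
bound over the iterations is needed.
-/

local notation "‖" x "‖₂" => ‖WithLp.toLp 2 x‖

section ThresholdingRule

/-- `s` thresholds like the SCAD and MCP updates: it kills small arguments and leaves large ones
unpenalized. Only these two properties enter the oracle property; `M` bounds the absolute values
`|u / d|` that may be shrunk. -/
structure IsThresholdingRule (s : ℝ → ℝ) (L M d : ℝ) : Prop where
  eq_zero : ∀ u, |u| ≤ L → s u = 0
  eq_div : ∀ u, M * d < |u| → s u = u / d

variable {a L d : ℝ}

theorem isThresholdingRule_scadUpdate (ha : 2 ≤ a) (hL : 0 ≤ L) (hd : 1 ≤ d) :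
    IsThresholdingRule (scadUpdate a L d) L (a * L) d where
  eq_zero u hu := by
    rw [scadUpdate, if_pos (by nlinarith), max_eq_right (by linarith)]
    simp
  eq_div u hu := by
    have ordered : (d + 1) * L ≤ a * L * d := by nlinarith [mul_nonneg hL (by linarith : 0 ≤ d)]
    rw [scadUpdate, if_neg (by linarith), if_neg (by linarith)]

theorem isThresholdingRule_mcpUpdate (ha : 1 ≤ a) (hL : 0 ≤ L) (hd : 1 ≤ d) :
    IsThresholdingRule (mcpUpdate a L d) L (a * L) d where
  eq_zero u hu := by
    have ordered : L ≤ a * L * d := by nlinarith [mul_nonneg hL (by linarith : 0 ≤ d)]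
    rw [mcpUpdate, if_pos (by linarith), max_eq_right (by linarith)]
    simp
  eq_div u hu := by rw [mcpUpdate, if_neg (by linarith)]

theorem measurable_real_sign : Measurable Real.sign :=
  Measurable.ite measurableSet_Iio measurable_const
    (Measurable.ite measurableSet_Ioi measurable_const measurable_const)

theorem measurable_scadUpdate (a L d : ℝ) : Measurable (scadUpdate a L d) := by
  have := measurable_real_sign
  exact Measurable.ite (measurableSet_le (by fun_prop) (by fun_prop)) (by fun_prop)
    (Measurable.ite (measurableSet_le (by fun_prop) (by fun_prop)) (by fun_prop) (by fun_prop))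

theorem measurable_mcpUpdate (a L d : ℝ) : Measurable (mcpUpdate a L d) := by
  have := measurable_real_sign
  exact Measurable.ite (measurableSet_le (by fun_prop) (by fun_prop)) (by fun_prop) (by fun_prop)

theorem measurable_oemSeq {n m : ℕ} {ι : Type*} [Fintype ι] [DecidableEq ι] {s : ℝ → ℝ}
    (hs : Measurable s) (X : Matrix (Fin n) ι ℝ) (Δ : Matrix (Fin m) ι ℝ) (k : ℕ) :
    Measurable fun Y => oemSeq s X Δ Y k := by
  induction k with
  | zero =>
    have : Continuous fun Y => ols X Y := by unfold ols; fun_prop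
    exact this.measurable
  | succ k ih =>
    have : Continuous fun q : (Fin n → ℝ) × (ι → ℝ) => oemVec X Δ q.1 q.2 := by
      unfold oemVec; fun_prop
    exact measurable_pi_lambda _ fun j => hs.comp <|
      (measurable_pi_apply j).comp (this.measurable.comp (measurable_id.prodMk ih))

theorem IsThresholdingRule.comp_smul_add {s : ℝ → ℝ} {M : ℝ} (hs : IsThresholdingRule s L M d)
    (hd : 0 < d) {ι₁ ι₂ : Type*} {β v : ι₁ ⊕ ι₂ → ℝ} (hβ₂ : ∀ j, β (Sum.inr j) = 0)
    (h₁ : ∀ j, |v (Sum.inl j)| + M < |β (Sum.inl j)|) (h₂ : ∀ j, d * |v (Sum.inr j)| ≤ L) :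
    s ∘ (d • (β + v)) = β + Sum.elim (v ∘ Sum.inl) 0 := by
  ext (j | j)
  · have large : M < |β (Sum.inl j) + v (Sum.inl j)| := by
      linarith [h₁ j, abs_sub_abs_le_abs_add (β (Sum.inl j)) (v (Sum.inl j))]
    have kept : s (d * (β (Sum.inl j) + v (Sum.inl j))) = β (Sum.inl j) + v (Sum.inl j) := by
      rw [hs.eq_div _ ?_, mul_div_cancel_left₀ _ hd.ne']
      rw [abs_mul, abs_of_pos hd, mul_comm]
      gcongr
    simpa [mul_add] using kept
  · have killed : s (d * v (Sum.inr j)) = 0 :=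
      hs.eq_zero _ (by rw [abs_mul, abs_of_pos hd]; exact h₂ j)
    simpa [hβ₂] using killed

end ThresholdingRule

section GradientStep

variable {ι : Type*} [Fintype ι]

/-- A step of gradient descent, with step size `1 / d`, for the quadratic function
`x ↦ x'Gx / 2 - w'x`, whose minimizer is `G⁻¹ w`. Where no thresholding takes place, the estimation
errors of the OEM iterates evolve in this way, `G` being the Gram matrix and `w` the score. -/
noncomputable def gradientStep (G : Matrix ι ι ℝ) (d : ℝ) (w x : ι → ℝ) : ι → ℝ :=
  x + d⁻¹ • (w - G *ᵥ x)

theorem gradientStep_inv_mulVec [DecidableEq ι] {G : Matrix ι ι ℝ} (hG : IsUnit G.det) (d : ℝ)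
    (w : ι → ℝ) : gradientStep G d w (G⁻¹ *ᵥ w) = G⁻¹ *ᵥ w := by
  simp [gradientStep, mulVec_mulVec, mul_nonsing_inv _ hG]

theorem iterate_gradientStep_sub [DecidableEq ι] {G : Matrix ι ι ℝ} (hG : IsUnit G.det) (d : ℝ)
    (w x : ι → ℝ) (k : ℕ) :
    (gradientStep G d w)^[k] x - G⁻¹ *ᵥ w = (1 - d⁻¹ • G) ^ k *ᵥ (x - G⁻¹ *ᵥ w) := by
  have step_sub (y : ι → ℝ) :
      gradientStep G d w y - G⁻¹ *ᵥ w = (1 - d⁻¹ • G) *ᵥ (y - G⁻¹ *ᵥ w) := by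
    have stationary : G *ᵥ (G⁻¹ *ᵥ w) = w := by
      rw [mulVec_mulVec, mul_nonsing_inv _ hG, one_mulVec]
    rw [sub_mulVec, one_mulVec, smul_mulVec, mulVec_sub, stationary, gradientStep, ← neg_sub w,
      smul_neg]
    abel
  induction k with
  | zero => simp
  | succ k ih =>
    rw [Function.iterate_succ_apply', step_sub, ih, mulVec_mulVec, pow_succ']

variable {ι₁ ι₂ : Type*} [Fintype ι₁] [Fintype ι₂]

theorem mulVec_sumElim_zero (G : Matrix (ι₁ ⊕ ι₂) (ι₁ ⊕ ι₂) ℝ) (r : ι₁ → ℝ) :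
    G *ᵥ Sum.elim r 0 = Sum.elim (G.toBlocks₁₁ *ᵥ r) (G.toBlocks₂₁ *ᵥ r) := by
  conv_lhs => rw [← fromBlocks_toBlocks G, fromBlocks_mulVec]
  simp

theorem gradientStep_sumElim_zero (G : Matrix (ι₁ ⊕ ι₂) (ι₁ ⊕ ι₂) ℝ) (d : ℝ) (w : ι₁ ⊕ ι₂ → ℝ)
    (r : ι₁ → ℝ) :
    gradientStep G d w (Sum.elim r 0) =
      Sum.elim (gradientStep G.toBlocks₁₁ d (w ∘ Sum.inl) r)
        (d⁻¹ • (w ∘ Sum.inr - G.toBlocks₂₁ *ᵥ r)) := by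
  ext (j | j) <;> simp [gradientStep, mulVec_sumElim_zero]

end GradientStep

section LinearModel

variable {n m : ℕ} {ι : Type*}

/-- The score `X'e / n` of the linear model with regression matrix `X` at the error vector `e`. -/
noncomputable def scaledScore (X : Matrix (Fin n) ι ℝ) (e : Fin n → ℝ) : ι → ℝ :=
  (n : ℝ)⁻¹ • (Xᵀ *ᵥ e)

theorem posSemidef_normGram [Finite ι] (X : Matrix (Fin n) ι ℝ) : (normGram X).PosSemidef := by
  simpa [normGram] using
    (posSemidef_conjTranspose_mul_self X).smul (inv_nonneg.2 (Nat.cast_nonneg (α := ℝ) n))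

variable [Fintype ι]

theorem inv_smul_transpose_mulVec_add (X : Matrix (Fin n) ι ℝ) (β : ι → ℝ) (e : Fin n → ℝ) :
    (n : ℝ)⁻¹ • (Xᵀ *ᵥ (X *ᵥ β + e)) = normGram X *ᵥ β + scaledScore X e := by
  simp [normGram, scaledScore, mulVec_add, smul_mulVec, mulVec_mulVec]

theorem ols_mulVec_add [DecidableEq ι] {X : Matrix (Fin n) ι ℝ} (hn : n ≠ 0)
    (hG : IsUnit (normGram X).det) (β : ι → ℝ) (e : Fin n → ℝ) :
    ols X (X *ᵥ β + e) = β + (normGram X)⁻¹ *ᵥ scaledScore X e := by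
  have hn' : (n : ℝ) ≠ 0 := Nat.cast_ne_zero.2 hn
  have : Invertible (n : ℝ) := invertibleOfNonzero hn'
  have gram_eq : Xᵀ * X = (n : ℝ) • normGram X := by rw [normGram, smul_inv_smul₀ hn']
  have response_eq : Xᵀ *ᵥ (X *ᵥ β + e) = (n : ℝ) • (normGram X *ᵥ β + scaledScore X e) := by
    rw [← inv_smul_transpose_mulVec_add, smul_inv_smul₀ hn']
  rw [ols, response_eq, gram_eq, inv_smul _ _ hG, mulVec_smul, smul_mulVec, invOf_eq_inv,
    smul_inv_smul₀ hn', mulVec_add, mulVec_mulVec, nonsing_inv_mul _ hG, one_mulVec]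

theorem oemVec_mulVec_add [DecidableEq ι] {X : Matrix (Fin n) ι ℝ} {Δ : Matrix (Fin m) ι ℝ} {d : ℝ}
    (hd : d ≠ 0) (hΔ : normGram X + Δᵀ * Δ = d • (1 : Matrix ι ι ℝ)) (β x : ι → ℝ)
    (e : Fin n → ℝ) :
    oemVec X Δ (X *ᵥ β + e) (β + x) =
      d • (β + gradientStep (normGram X) d (scaledScore X e) x) := by
  rw [oemVec, inv_smul_transpose_mulVec_add, eq_sub_of_add_eq' hΔ, gradientStep, smul_add,
    smul_add, smul_inv_smul₀ hd, sub_mulVec, smul_mulVec, one_mulVec, mulVec_add, smul_add]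
  abel

end LinearModel

section OperatorNorm

open scoped Matrix.Norms.L2Operator

variable {ι κ : Type*} [Fintype ι] [Fintype κ]

theorem abs_apply_le_norm_toLp (x : ι → ℝ) (j : ι) : |x j| ≤ ‖x‖₂ :=
  PiLp.norm_apply_le (WithLp.toLp 2 x) j

theorem norm_toLp_sq (x : ι → ℝ) : ‖x‖₂ ^ 2 = x ⬝ᵥ x := by
  rw [EuclideanSpace.real_norm_sq_eq]
  exact Finset.sum_congr rfl fun _ _ => sq _

theorem norm_toLp_comp_le {f : κ → ι} (hf : Function.Injective f) (x : ι → ℝ) :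
    ‖x ∘ f‖₂ ≤ ‖x‖₂ := by
  rw [EuclideanSpace.norm_eq, EuclideanSpace.norm_eq]
  refine Real.sqrt_le_sqrt ?_
  calc ∑ j, ‖x (f j)‖ ^ 2 = ∑ i ∈ Finset.univ.map ⟨f, hf⟩, ‖x i‖ ^ 2 := by simp
    _ ≤ ∑ i, ‖x i‖ ^ 2 :=
      Finset.sum_le_sum_of_subset_of_nonneg (Finset.subset_univ _) fun _ _ _ => sq_nonneg _

variable [DecidableEq ι]

theorem norm_toLp_mulVec_le (A : Matrix κ ι ℝ) (x : ι → ℝ) : ‖A *ᵥ x‖₂ ≤ ‖A‖ * ‖x‖₂ :=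
  l2_opNorm_mulVec A (WithLp.toLp 2 x)

theorem norm_toLp_pow_mulVec_le (A : Matrix ι ι ℝ) (k : ℕ) (x : ι → ℝ) :
    ‖A ^ k *ᵥ x‖₂ ≤ ‖A‖ ^ k * ‖x‖₂ := by
  induction k with
  | zero => simp
  | succ k ih =>
    rw [pow_succ', ← mulVec_mulVec, pow_succ', mul_assoc]
    exact (norm_toLp_mulVec_le _ _).trans (by gcongr)

theorem norm_le_maxEigenvalue {A : Matrix ι ι ℝ} (hA : A.PosSemidef) : ‖A‖ ≤ maxEigenvalue A := by
  have hA' := hA.isHermitian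
  have norm_eq : ‖A‖ = ‖hA'.eigenvalues‖ := by
    conv_lhs => rw [hA'.spectral_theorem, Unitary.conjStarAlgAut_apply]
    rw [← Unitary.coe_star, CStarRing.norm_mul_coe_unitary, CStarRing.norm_coe_unitary_mul,
      l2_opNorm_diagonal]
    rfl
  have eigenvalue_set : {μ : ℝ | Module.End.HasEigenvalue (toLin' A) μ} =
      Set.range hA'.eigenvalues := by
    ext μ
    rw [Set.mem_ofPred_eq, Module.End.hasEigenvalue_iff_mem_spectrum, spectrum_toLin',
      hA'.spectrum_real_eq_range_eigenvalues]
  rw [norm_eq, maxEigenvalue, eigenvalue_set, pi_norm_le_iff_of_nonneg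
    (Real.sSup_nonneg (Set.forall_mem_range.2 hA.eigenvalues_nonneg))]
  intro i
  rw [Real.norm_of_nonneg (hA.eigenvalues_nonneg i)]
  exact le_csSup (Set.finite_range _).bddAbove (Set.mem_range_self i)

theorem tendsto_matrix_inv {α : Type*} {l : Filter α} {M : α → Matrix ι ι ℝ} {M₀ : Matrix ι ι ℝ}
    (h : Tendsto M l (𝓝 M₀)) (h₀ : M₀.det ≠ 0) : Tendsto (fun a => (M a)⁻¹) l (𝓝 M₀⁻¹) := by
  have continuousAt_ring_inverse : ContinuousAt Ring.inverse M₀.det := by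
    rw [Ring.inverse_eq_inv']
    exact continuousAt_inv₀ h₀
  exact (continuousAt_matrix_inv M₀ continuousAt_ring_inverse).tendsto.comp h

theorem eventually_isUnit_det_and_norm_inv_le {α : Type*} {l : Filter α} {M : α → Matrix ι ι ℝ}
    {M₀ : Matrix ι ι ℝ} (h : Tendsto M l (𝓝 M₀)) (h₀ : M₀.det ≠ 0) :
    ∀ᶠ a in l, IsUnit (M a).det ∧ ‖(M a)⁻¹‖ ≤ ‖M₀⁻¹‖ + 1 := by
  have tendsto_det : Tendsto (fun a => (M a).det) l (𝓝 M₀.det) :=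
    (continuous_id.matrix_det.tendsto M₀).comp h
  filter_upwards [tendsto_det.eventually_ne h₀,
    (tendsto_matrix_inv h h₀).norm.eventually_le_const (lt_add_one _)] with a hdet hnorm
  exact ⟨hdet.isUnit, hnorm⟩

theorem norm_transpose_mul_self (D : Matrix κ ι ℝ) : ‖Dᵀ * D‖ = ‖D‖ ^ 2 := by
  classical
  simpa [sq] using l2_opNorm_conjTranspose_mul_self D

theorem norm_transpose_mul_le {ι' : Type*} [Fintype ι'] [DecidableEq ι'] (D : Matrix κ ι ℝ)
    (E : Matrix κ ι' ℝ) : ‖Dᵀ * E‖ ≤ ‖D‖ * ‖E‖ := by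
  classical
  rw [← l2_opNorm_conjTranspose D]
  exact l2_opNorm_mul Dᴴ E

theorem norm_sq_le_of_posSemidef_add {G : Matrix ι ι ℝ} {D : Matrix κ ι ℝ} {d : ℝ} (hd : 0 ≤ d)
    (hG : G.PosSemidef) (h : G + Dᵀ * D = d • (1 : Matrix ι ι ℝ)) : ‖D‖ ^ 2 ≤ d := by
  have mulVec_le (x : ι → ℝ) : ‖D *ᵥ x‖₂ ≤ √d * ‖x‖₂ := by
    have quadratic : x ⬝ᵥ G *ᵥ x + ‖D *ᵥ x‖₂ ^ 2 = d * ‖x‖₂ ^ 2 := by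
      have := congrArg (fun M => x ⬝ᵥ M *ᵥ x) h
      rw [norm_toLp_sq, norm_toLp_sq]
      simpa [add_mulVec, smul_mulVec, ← mulVec_mulVec, dotProduct_mulVec, vecMul_transpose]
        using this
    have nonneg : 0 ≤ x ⬝ᵥ G *ᵥ x := by simpa using hG.dotProduct_mulVec_nonneg x
    refine abs_le_of_sq_le_sq' ?_ (by positivity) |>.2
    rw [mul_pow, Real.sq_sqrt hd]
    linarith
  rw [← Real.le_sqrt (norm_nonneg _) hd, l2_opNorm_def]
  exact ContinuousLinearMap.opNorm_le_bound _ (Real.sqrt_nonneg d) fun x => mulVec_le x.ofLp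

end OperatorNorm

section Completion

open scoped Matrix.Norms.L2Operator

variable {ι₁ ι₂ κ : Type*} [Fintype κ] [DecidableEq ι₁] [DecidableEq ι₂]
  {G : Matrix (ι₁ ⊕ ι₂) (ι₁ ⊕ ι₂) ℝ} {Δ : Matrix κ (ι₁ ⊕ ι₂) ℝ} {d : ℝ}

theorem toBlocks₁₁_add_transpose_mul (h : G + Δᵀ * Δ = d • (1 : Matrix (ι₁ ⊕ ι₂) (ι₁ ⊕ ι₂) ℝ)) :
    G.toBlocks₁₁ + Δ.toCols₁ᵀ * Δ.toCols₁ = d • (1 : Matrix ι₁ ι₁ ℝ) := by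
  ext i j
  simpa [toBlocks₁₁, one_apply, mul_apply] using congrFun₂ h (Sum.inl i) (Sum.inl j)

theorem toBlocks₂₂_add_transpose_mul (h : G + Δᵀ * Δ = d • (1 : Matrix (ι₁ ⊕ ι₂) (ι₁ ⊕ ι₂) ℝ)) :
    G.toBlocks₂₂ + Δ.toCols₂ᵀ * Δ.toCols₂ = d • (1 : Matrix ι₂ ι₂ ℝ) := by
  ext i j
  simpa [toBlocks₂₂, one_apply, mul_apply] using congrFun₂ h (Sum.inr i) (Sum.inr j)

theorem toBlocks₁₂_eq_neg_transpose_mul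
    (h : G + Δᵀ * Δ = d • (1 : Matrix (ι₁ ⊕ ι₂) (ι₁ ⊕ ι₂) ℝ)) :
    G.toBlocks₁₂ = -(Δ.toCols₁ᵀ * Δ.toCols₂) := by
  ext i j
  refine eq_neg_of_add_eq_zero_left ?_
  simpa [toBlocks₁₂, mul_apply] using congrFun₂ h (Sum.inl i) (Sum.inr j)

theorem transpose_mul_toCols₁ (hd : d ≠ 0)
    (h : G + Δᵀ * Δ = d • (1 : Matrix (ι₁ ⊕ ι₂) (ι₁ ⊕ ι₂) ℝ)) :
    Δ.toCols₁ᵀ * Δ.toCols₁ = d • (1 - d⁻¹ • G.toBlocks₁₁) := by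
  rw [smul_sub, smul_inv_smul₀ hd, eq_sub_iff_add_eq', toBlocks₁₁_add_transpose_mul h]

theorem posSemidef_one_sub_toBlocks₁₁ [Finite ι₁] (hd : 0 < d)
    (h : G + Δᵀ * Δ = d • (1 : Matrix (ι₁ ⊕ ι₂) (ι₁ ⊕ ι₂) ℝ)) :
    (1 - d⁻¹ • G.toBlocks₁₁).PosSemidef := by
  rw [← inv_smul_smul₀ hd.ne' (1 - d⁻¹ • G.toBlocks₁₁), ← transpose_mul_toCols₁ hd.ne' h]
  exact (posSemidef_conjTranspose_mul_self Δ.toCols₁).smul (inv_nonneg.2 hd.le)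

variable [Fintype ι₁]

theorem norm_toCols₁_sq (hd : 0 < d)
    (h : G + Δᵀ * Δ = d • (1 : Matrix (ι₁ ⊕ ι₂) (ι₁ ⊕ ι₂) ℝ)) :
    ‖Δ.toCols₁‖ ^ 2 = d * ‖1 - d⁻¹ • G.toBlocks₁₁‖ := by
  rw [← norm_transpose_mul_self, transpose_mul_toCols₁ hd.ne' h, norm_smul,
    Real.norm_of_nonneg hd.le]

theorem norm_one_sub_toBlocks₁₁_le_one (hd : 0 < d) (hG : G.PosSemidef)
    (h : G + Δᵀ * Δ = d • (1 : Matrix (ι₁ ⊕ ι₂) (ι₁ ⊕ ι₂) ℝ)) :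
    ‖1 - d⁻¹ • G.toBlocks₁₁‖ ≤ 1 := by
  have norm_sq_le : ‖Δ.toCols₁‖ ^ 2 ≤ d :=
    norm_sq_le_of_posSemidef_add hd.le (hG.submatrix Sum.inl) (toBlocks₁₁_add_transpose_mul h)
  rw [norm_toCols₁_sq hd h] at norm_sq_le
  exact le_of_mul_le_mul_left (norm_sq_le.trans_eq (mul_one d).symm) hd

variable [Fintype ι₂]

theorem norm_toBlocks₁₂_le (hd : 0 < d) (hG : G.PosSemidef)
    (h : G + Δᵀ * Δ = d • (1 : Matrix (ι₁ ⊕ ι₂) (ι₁ ⊕ ι₂) ℝ)) :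
    ‖G.toBlocks₁₂‖ ≤ d * √‖1 - d⁻¹ • G.toBlocks₁₁‖ := by
  have norm_toCols₁ : ‖Δ.toCols₁‖ = √d * √‖1 - d⁻¹ • G.toBlocks₁₁‖ := by
    rw [← Real.sqrt_mul hd.le, ← norm_toCols₁_sq hd h, Real.sqrt_sq (norm_nonneg _)]
  have norm_toCols₂_le : ‖Δ.toCols₂‖ ≤ √d := Real.le_sqrt_of_sq_le <|
    norm_sq_le_of_posSemidef_add hd.le (hG.submatrix Sum.inr) (toBlocks₂₂_add_transpose_mul h)
  calc ‖G.toBlocks₁₂‖ ≤ ‖Δ.toCols₁‖ * ‖Δ.toCols₂‖ := by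
        rw [toBlocks₁₂_eq_neg_transpose_mul h, norm_neg]
        exact norm_transpose_mul_le _ _
    _ ≤ √d * √‖1 - d⁻¹ • G.toBlocks₁₁‖ * √d := by rw [norm_toCols₁]; gcongr
    _ = d * √‖1 - d⁻¹ • G.toBlocks₁₁‖ := by rw [mul_right_comm, Real.mul_self_sqrt hd.le]

theorem norm_toBlocks₂₁_le (hd : 0 < d) (hG : G.PosSemidef)
    (h : G + Δᵀ * Δ = d • (1 : Matrix (ι₁ ⊕ ι₂) (ι₁ ⊕ ι₂) ℝ)) : ‖G.toBlocks₂₁‖ ≤ d := by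
  have symm : G.toBlocks₂₁ = G.toBlocks₁₂ᴴ := by
    ext i j
    exact (hG.isHermitian.apply (Sum.inr i) (Sum.inl j)).symm
  rw [symm, l2_opNorm_conjTranspose]
  refine (norm_toBlocks₁₂_le hd hG h).trans (mul_le_of_le_one_right hd.le ?_)
  exact Real.sqrt_le_one.2 (norm_one_sub_toBlocks₁₁_le_one hd hG h)

end Completion

section OLSError

open scoped Matrix.Norms.L2Operator

variable {ι₁ ι₂ κ : Type*} [Fintype ι₁] [Fintype ι₂] [Fintype κ] [DecidableEq ι₁] [DecidableEq ι₂]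
  {G : Matrix (ι₁ ⊕ ι₂) (ι₁ ⊕ ι₂) ℝ} {Δ : Matrix κ (ι₁ ⊕ ι₂) ℝ} {d K : ℝ}

theorem inv_mulVec_comp_inl_sub (hG : IsUnit G.det) (hG₁ : IsUnit G.toBlocks₁₁.det)
    (w : ι₁ ⊕ ι₂ → ℝ) :
    (G⁻¹ *ᵥ w) ∘ Sum.inl - G.toBlocks₁₁⁻¹ *ᵥ (w ∘ Sum.inl) =
      -(G.toBlocks₁₁⁻¹ *ᵥ (G.toBlocks₁₂ *ᵥ ((G⁻¹ *ᵥ w) ∘ Sum.inr))) := by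
  have normal_equations : w ∘ Sum.inl =
      G.toBlocks₁₁ *ᵥ ((G⁻¹ *ᵥ w) ∘ Sum.inl) + G.toBlocks₁₂ *ᵥ ((G⁻¹ *ᵥ w) ∘ Sum.inr) := by
    have solves : G *ᵥ (G⁻¹ *ᵥ w) = w := by rw [mulVec_mulVec, mul_nonsing_inv _ hG, one_mulVec]
    conv_lhs => rw [← solves, ← fromBlocks_toBlocks G, fromBlocks_mulVec, fromBlocks_toBlocks]
    rfl
  rw [normal_equations, mulVec_add, mulVec_mulVec, nonsing_inv_mul _ hG₁, one_mulVec,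
    sub_add_cancel_left]

theorem norm_inv_mulVec_comp_inl_sub_le (hd : 0 < d) (hG : G.PosSemidef)
    (h : G + Δᵀ * Δ = d • (1 : Matrix (ι₁ ⊕ ι₂) (ι₁ ⊕ ι₂) ℝ)) (hdet : IsUnit G.det)
    (hdet₁ : IsUnit G.toBlocks₁₁.det) (hK : ‖G⁻¹‖ ≤ K) (hK₁ : ‖G.toBlocks₁₁⁻¹‖ ≤ K)
    (w : ι₁ ⊕ ι₂ → ℝ) :
    ‖(G⁻¹ *ᵥ w) ∘ Sum.inl - G.toBlocks₁₁⁻¹ *ᵥ (w ∘ Sum.inl)‖₂ ≤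
      K ^ 2 * d * √‖1 - d⁻¹ • G.toBlocks₁₁‖ * ‖w‖₂ := by
  have hK₀ : 0 ≤ K := (norm_nonneg _).trans hK
  have second_block : ‖(G⁻¹ *ᵥ w) ∘ Sum.inr‖₂ ≤ K * ‖w‖₂ :=
    (norm_toLp_comp_le Sum.inr_injective _).trans <|
      (norm_toLp_mulVec_le _ _).trans (by gcongr)
  rw [inv_mulVec_comp_inl_sub hdet hdet₁, WithLp.toLp_neg, norm_neg]
  calc ‖G.toBlocks₁₁⁻¹ *ᵥ (G.toBlocks₁₂ *ᵥ ((G⁻¹ *ᵥ w) ∘ Sum.inr))‖₂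
      ≤ ‖G.toBlocks₁₁⁻¹‖ * (‖G.toBlocks₁₂‖ * ‖(G⁻¹ *ᵥ w) ∘ Sum.inr‖₂) :=
        (norm_toLp_mulVec_le _ _).trans (by gcongr; exact norm_toLp_mulVec_le _ _)
    _ ≤ K * (d * √‖1 - d⁻¹ • G.toBlocks₁₁‖ * (K * ‖w‖₂)) := by
        gcongr
        exact norm_toBlocks₁₂_le hd hG h
    _ = K ^ 2 * d * √‖1 - d⁻¹ • G.toBlocks₁₁‖ * ‖w‖₂ := by ring

/-- The distance from the initial estimator to the limit contributes a factor `√‖1 - d⁻¹ • G₁₁‖`,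
so that `k` gradient steps are as good as `k + 1` of them. -/
theorem norm_iterate_gradientStep_sub_le (hd : 0 < d) (hG : G.PosSemidef)
    (h : G + Δᵀ * Δ = d • (1 : Matrix (ι₁ ⊕ ι₂) (ι₁ ⊕ ι₂) ℝ)) (hdet : IsUnit G.det)
    (hdet₁ : IsUnit G.toBlocks₁₁.det) (hK : ‖G⁻¹‖ ≤ K) (hK₁ : ‖G.toBlocks₁₁⁻¹‖ ≤ K)
    (w : ι₁ ⊕ ι₂ → ℝ) (k : ℕ) :
    ‖(gradientStep G.toBlocks₁₁ d (w ∘ Sum.inl))^[k] ((G⁻¹ *ᵥ w) ∘ Sum.inl) -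
        G.toBlocks₁₁⁻¹ *ᵥ (w ∘ Sum.inl)‖₂ ≤
      K ^ 2 * d * √(‖1 - d⁻¹ • G.toBlocks₁₁‖ ^ (k + 1)) * ‖w‖₂ := by
  set q := ‖1 - d⁻¹ • G.toBlocks₁₁‖
  have hq₀ : 0 ≤ q := norm_nonneg _
  have hq₁ : q ≤ 1 := norm_one_sub_toBlocks₁₁_le_one hd hG h
  have pow_mul_sqrt_le : q ^ k * √q ≤ √(q ^ (k + 1)) := by
    refine Real.le_sqrt_of_sq_le ?_
    rw [mul_pow, Real.sq_sqrt hq₀, ← pow_mul, ← pow_succ]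
    exact pow_le_pow_of_le_one hq₀ hq₁ (by omega)
  rw [iterate_gradientStep_sub hdet₁]
  calc _ ≤ q ^ k * (K ^ 2 * d * √q * ‖w‖₂) :=
        (norm_toLp_pow_mulVec_le _ _ _).trans (mul_le_mul_of_nonneg_left
          (norm_inv_mulVec_comp_inl_sub_le hd hG h hdet hdet₁ hK hK₁ w) (by positivity))
    _ = K ^ 2 * d * (q ^ k * √q) * ‖w‖₂ := by ring
    _ ≤ K ^ 2 * d * √(q ^ (k + 1)) * ‖w‖₂ := by gcongr

theorem norm_comp_inr_sub_toBlocks₂₁_mulVec_le (hd : 0 < d) (hG : G.PosSemidef)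
    (h : G + Δᵀ * Δ = d • (1 : Matrix (ι₁ ⊕ ι₂) (ι₁ ⊕ ι₂) ℝ)) (w : ι₁ ⊕ ι₂ → ℝ) {r : ι₁ → ℝ}
    {R : ℝ} (hr : ‖r‖₂ ≤ R) : ‖w ∘ Sum.inr - G.toBlocks₂₁ *ᵥ r‖₂ ≤ ‖w‖₂ + d * R :=
  calc ‖w ∘ Sum.inr - G.toBlocks₂₁ *ᵥ r‖₂ ≤ ‖w ∘ Sum.inr‖₂ + ‖G.toBlocks₂₁ *ᵥ r‖₂ :=
        norm_sub_le (WithLp.toLp 2 (w ∘ Sum.inr)) (WithLp.toLp 2 (G.toBlocks₂₁ *ᵥ r))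
    _ ≤ ‖w‖₂ + ‖G.toBlocks₂₁‖ * ‖r‖₂ :=
        add_le_add (norm_toLp_comp_le Sum.inr_injective w) (norm_toLp_mulVec_le _ _)
    _ ≤ ‖w‖₂ + d * R := by
        gcongr
        exact norm_toBlocks₂₁_le hd hG h

theorem norm_iterate_gradientStep_le (hdet₁ : IsUnit G.toBlocks₁₁.det)
    (hq : ‖1 - d⁻¹ • G.toBlocks₁₁‖ ≤ 1) (hK : ‖G⁻¹‖ ≤ K) (hK₁ : ‖G.toBlocks₁₁⁻¹‖ ≤ K)
    (w : ι₁ ⊕ ι₂ → ℝ) (k : ℕ) :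
    ‖(gradientStep G.toBlocks₁₁ d (w ∘ Sum.inl))^[k] ((G⁻¹ *ᵥ w) ∘ Sum.inl)‖₂ ≤
      3 * K * ‖w‖₂ := by
  have start_le : ‖(G⁻¹ *ᵥ w) ∘ Sum.inl‖₂ ≤ K * ‖w‖₂ :=
    (norm_toLp_comp_le Sum.inl_injective _).trans <|
      (norm_toLp_mulVec_le _ _).trans (by gcongr)
  have limit_le : ‖G.toBlocks₁₁⁻¹ *ᵥ (w ∘ Sum.inl)‖₂ ≤ K * ‖w‖₂ :=
    (norm_toLp_mulVec_le _ _).trans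
      (mul_le_mul hK₁ (norm_toLp_comp_le Sum.inl_injective w) (norm_nonneg _)
        ((norm_nonneg _).trans hK))
  set v := (G⁻¹ *ᵥ w) ∘ Sum.inl
  set u := G.toBlocks₁₁⁻¹ *ᵥ (w ∘ Sum.inl)
  have contraction : ‖(1 - d⁻¹ • G.toBlocks₁₁) ^ k *ᵥ (v - u)‖₂ ≤ ‖v‖₂ + ‖u‖₂ := by
    refine (norm_toLp_pow_mulVec_le _ _ _).trans <|
      (mul_le_of_le_one_left (norm_nonneg _) (pow_le_one₀ (norm_nonneg _) hq)).trans ?_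
    exact norm_sub_le (WithLp.toLp 2 v) (WithLp.toLp 2 u)
  rw [← sub_add_cancel ((gradientStep _ d (w ∘ Sum.inl))^[k] v) u, iterate_gradientStep_sub hdet₁]
  calc _ ≤ ‖(1 - d⁻¹ • G.toBlocks₁₁) ^ k *ᵥ (v - u)‖₂ + ‖u‖₂ :=
        norm_add_le (WithLp.toLp 2 _) (WithLp.toLp 2 u)
    _ ≤ 3 * K * ‖w‖₂ := by linarith

end OLSError

section OEM

variable {n m : ℕ} {ι₁ ι₂ : Type*} [Fintype ι₁] [Fintype ι₂] [DecidableEq ι₁] [DecidableEq ι₂]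
  {s : ℝ → ℝ} {L M d : ℝ} {X : Matrix (Fin n) (ι₁ ⊕ ι₂) ℝ} {Δ : Matrix (Fin m) (ι₁ ⊕ ι₂) ℝ}
  {β : ι₁ ⊕ ι₂ → ℝ} {e : Fin n → ℝ}

theorem oemSeq_succ_of_oemSeq_eq_add (hs : IsThresholdingRule s L M d) (hd : 0 < d)
    (hΔ : normGram X + Δᵀ * Δ = d • (1 : Matrix (ι₁ ⊕ ι₂) (ι₁ ⊕ ι₂) ℝ))
    (hβ₂ : ∀ j, β (Sum.inr j) = 0) {k : ℕ} {x v : ι₁ ⊕ ι₂ → ℝ}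
    (hx : oemSeq s X Δ (X *ᵥ β + e) k = β + x)
    (hv : gradientStep (normGram X) d (scaledScore X e) x = v)
    (h₁ : ∀ j, |v (Sum.inl j)| + M < |β (Sum.inl j)|) (h₂ : ∀ j, d * |v (Sum.inr j)| ≤ L) :
    oemSeq s X Δ (X *ᵥ β + e) (k + 1) = β + Sum.elim (v ∘ Sum.inl) 0 := by
  rw [← hs.comp_smul_add hd hβ₂ h₁ h₂, ← hv, ← oemVec_mulVec_add hd.ne' hΔ, ← hx]
  rfl

open scoped Matrix.Norms.L2Operator

theorem oemSeq_succ_eq (hs : IsThresholdingRule s L M d) (hd : 0 < d) (hn : n ≠ 0)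
    (hΔ : normGram X + Δᵀ * Δ = d • (1 : Matrix (ι₁ ⊕ ι₂) (ι₁ ⊕ ι₂) ℝ))
    (hdet : IsUnit (normGram X).det) (hdet₁ : IsUnit (normGram X).toBlocks₁₁.det) {K : ℝ}
    (hK : ‖(normGram X)⁻¹‖ ≤ K) (hK₁ : ‖(normGram X).toBlocks₁₁⁻¹‖ ≤ K)
    (hβ₂ : ∀ j, β (Sum.inr j) = 0)
    (hβ₁ : ∀ j, 3 * K * ‖scaledScore X e‖₂ + M < |β (Sum.inl j)|)
    (hL : (1 + 3 * d * K) * ‖scaledScore X e‖₂ ≤ L) (k : ℕ) :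
    oemSeq s X Δ (X *ᵥ β + e) (k + 1) =
      β + Sum.elim ((gradientStep (normGram X).toBlocks₁₁ d (scaledScore X e ∘ Sum.inl))^[k]
        (((normGram X)⁻¹ *ᵥ scaledScore X e) ∘ Sum.inl)) 0 := by
  have hG := posSemidef_normGram X
  have hq := norm_one_sub_toBlocks₁₁_le_one hd hG hΔ
  set G := normGram X
  set w := scaledScore X e
  have hKw : 0 ≤ K * ‖w‖₂ := mul_nonneg ((norm_nonneg _).trans hK) (norm_nonneg _)
  have norm_le (k : ℕ) := norm_iterate_gradientStep_le (d := d) hdet₁ hq hK hK₁ w k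
  induction k with
  | zero =>
    have ols_error_le (j) : |(G⁻¹ *ᵥ w) j| ≤ K * ‖w‖₂ :=
      (abs_apply_le_norm_toLp _ j).trans <| (norm_toLp_mulVec_le _ _).trans (by gcongr)
    refine oemSeq_succ_of_oemSeq_eq_add hs hd hΔ hβ₂ (ols_mulVec_add hn hdet β e)
      (gradientStep_inv_mulVec hdet d w) (fun j => ?_) fun j => ?_
    · linarith [hβ₁ j, ols_error_le (Sum.inl j)]
    · have := mul_le_mul_of_nonneg_left (ols_error_le (Sum.inr j)) hd.le
      linarith [mul_nonneg hd.le hKw, norm_nonneg (WithLp.toLp 2 w)]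
  | succ k ih =>
    rw [Function.iterate_succ_apply']
    refine oemSeq_succ_of_oemSeq_eq_add hs hd hΔ hβ₂ ih (gradientStep_sumElim_zero G d w _)
      (fun j => ?_) fun j => ?_
    · have step_le := (abs_apply_le_norm_toLp _ j).trans (norm_le (k + 1))
      rw [Function.iterate_succ_apply'] at step_le
      exact (add_le_add_left step_le M).trans_lt (hβ₁ j)
    · simp only [Sum.elim_inr, Pi.smul_apply, smul_eq_mul, abs_mul, abs_inv, abs_of_pos hd]
      rw [mul_inv_cancel_left₀ hd.ne']
      exact (abs_apply_le_norm_toLp _ j).trans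
        ((norm_comp_inr_sub_toBlocks₂₁_mulVec_le hd hG hΔ w (norm_le k)).trans
          (by linarith))

end OEM

section BlockLimits

variable {α ι₁ ι₂ : Type*} {l : Filter α} {G : α → Matrix (ι₁ ⊕ ι₂) (ι₁ ⊕ ι₂) ℝ}
  {S : Matrix (ι₁ ⊕ ι₂) (ι₁ ⊕ ι₂) ℝ}

theorem tendsto_toBlocks₁₁ (h : Tendsto G l (𝓝 S)) :
    Tendsto (fun a => (G a).toBlocks₁₁) l (𝓝 S.toBlocks₁₁) :=
  ((continuous_id.matrix_submatrix Sum.inl Sum.inl).tendsto S).comp h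

variable [Fintype ι₁] [DecidableEq ι₁]

theorem det_toBlocks₁₁_ne_zero (hS : S.PosDef) : S.toBlocks₁₁.det ≠ 0 :=
  (hS.submatrix Sum.inl_injective).det_pos.ne'

open scoped Matrix.Norms.L2Operator

variable [Fintype ι₂] [DecidableEq ι₂]

theorem exists_eventually_isUnit_det_and_norm_inv_le (hS : S.PosDef) (h : Tendsto G l (𝓝 S)) :
    ∃ K, ∀ᶠ a in l, (IsUnit (G a).det ∧ ‖(G a)⁻¹‖ ≤ K) ∧
      IsUnit (G a).toBlocks₁₁.det ∧ ‖(G a).toBlocks₁₁⁻¹‖ ≤ K := by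
  refine ⟨max (‖S⁻¹‖ + 1) (‖S.toBlocks₁₁⁻¹‖ + 1), ?_⟩
  filter_upwards [eventually_isUnit_det_and_norm_inv_le h hS.det_pos.ne',
    eventually_isUnit_det_and_norm_inv_le (tendsto_toBlocks₁₁ h) (det_toBlocks₁₁_ne_zero hS)]
    with a ha ha₁
  exact ⟨⟨ha.1, ha.2.trans (le_max_left _ _)⟩, ha₁.1, ha₁.2.trans (le_max_right _ _)⟩

end BlockLimits

section Asymptotics

open scoped Matrix.Norms.L2Operator

variable {ι₁ ι₂ : Type*} [Fintype ι₁] [Fintype ι₂] [DecidableEq ι₁] [DecidableEq ι₂]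
  {S : Matrix (ι₁ ⊕ ι₂) (ι₁ ⊕ ι₂) ℝ} {m : ℕ → ℕ} {Δ : ∀ n, Matrix (Fin (m n)) (ι₁ ⊕ ι₂) ℝ}
  {d : ℕ → ℝ}

theorem exists_eventually_le_of_isBigO_one {α : Type*} {l : Filter α} {f : α → ℝ}
    (hf : f =O[l] fun _ => (1 : ℝ)) : ∃ D, ∀ᶠ a in l, f a ≤ D := by
  obtain ⟨D, hD⟩ := hf.bound
  exact ⟨D, hD.mono fun a ha => (le_abs_self _).trans (by simpa using ha)⟩

theorem eventually_oemSeq_succ_eq {X : ∀ n, Matrix (Fin n) (ι₁ ⊕ ι₂) ℝ} {s : ℕ → ℝ → ℝ}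
    {L M : ℕ → ℝ} {β : ι₁ ⊕ ι₂ → ℝ} (hs : ∀ᶠ n in atTop, IsThresholdingRule (s n) (L n) (M n) (d n))
    (hL : Tendsto (fun n : ℕ => √(n : ℝ) * L n) atTop atTop) (hM : Tendsto M atTop (𝓝 0))
    (hS : S.PosDef) (hX : Tendsto (fun n => normGram (X n)) atTop (𝓝 S))
    (hd₀ : ∀ᶠ n in atTop, 0 < d n) (hd : d =O[atTop] fun _ => (1 : ℝ))
    (hΔ : ∀ᶠ n in atTop, normGram (X n) + (Δ n)ᵀ * Δ n =
      d n • (1 : Matrix (ι₁ ⊕ ι₂) (ι₁ ⊕ ι₂) ℝ))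
    (hβ₁ : ∀ j, β (Sum.inl j) ≠ 0) (hβ₂ : ∀ j, β (Sum.inr j) = 0) (R : ℝ) :
    ∀ᶠ n : ℕ in atTop, ∀ e : Fin n → ℝ, √(n : ℝ) * ‖scaledScore (X n) e‖₂ ≤ R → ∀ k,
      oemSeq (s n) (X n) (Δ n) (X n *ᵥ β + e) (k + 1) =
        β + Sum.elim ((gradientStep (normGram (X n)).toBlocks₁₁ (d n)
          (scaledScore (X n) e ∘ Sum.inl))^[k]
            (((normGram (X n))⁻¹ *ᵥ scaledScore (X n) e) ∘ Sum.inl)) 0 := by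
  obtain ⟨K, hK⟩ := exists_eventually_isUnit_det_and_norm_inv_le hS hX
  obtain ⟨D, hD⟩ := exists_eventually_le_of_isBigO_one hd
  have bias_tendsto : Tendsto (fun n : ℕ => 3 * K * (R / √(n : ℝ)) + M n) atTop (𝓝 0) := by
    have : Tendsto (fun n : ℕ => R / √(n : ℝ)) atTop (𝓝 0) :=
      tendsto_const_nhds.div_atTop (Real.tendsto_sqrt_atTop.comp tendsto_natCast_atTop_atTop)
    simpa using (this.const_mul (3 * K)).add hM
  have bias_lt : ∀ᶠ n : ℕ in atTop, ∀ j, 3 * K * (R / √(n : ℝ)) + M n < |β (Sum.inl j)| :=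
    eventually_all.2 fun j => bias_tendsto.eventually_lt_const (abs_pos.2 (hβ₁ j))
  filter_upwards [hs, hd₀, hΔ, hK, hD, bias_lt, eventually_gt_atTop 0,
    hL.eventually_ge_atTop ((1 + 3 * D * K) * R)]
    with n hs hd₀ hΔ ⟨⟨hdet, hK⟩, hdet₁, hK₁⟩ hD bias_lt hn hL e he
  have hK₀ : 0 ≤ K := (norm_nonneg _).trans hK
  have hD₀ : 0 < D := hd₀.trans_le hD
  have hn' : 0 < √(n : ℝ) := by positivity
  have score_le : ‖scaledScore (X n) e‖₂ ≤ R / √(n : ℝ) := (le_div_iff₀' hn').2 he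
  refine oemSeq_succ_eq hs hd₀ hn.ne' hΔ hdet hdet₁ hK hK₁ hβ₂
    (fun j => (bias_lt j).trans_le' (by gcongr)) (le_of_mul_le_mul_left ?_ hn')
  calc √(n : ℝ) * ((1 + 3 * d n * K) * ‖scaledScore (X n) e‖₂)
      = (1 + 3 * d n * K) * (√(n : ℝ) * ‖scaledScore (X n) e‖₂) := by ring
    _ ≤ (1 + 3 * D * K) * R := by gcongr
    _ ≤ √(n : ℝ) * L n := hL

theorem eventually_norm_smul_iterate_gradientStep_sub_lt {G : ℕ → Matrix (ι₁ ⊕ ι₂) (ι₁ ⊕ ι₂) ℝ}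
    (hS : S.PosDef) (hG : Tendsto G atTop (𝓝 S)) (hG' : ∀ n, (G n).PosSemidef)
    (hd₀ : ∀ᶠ n in atTop, 0 < d n) (hd : d =O[atTop] fun _ => (1 : ℝ))
    (hΔ : ∀ᶠ n in atTop, G n + (Δ n)ᵀ * Δ n = d n • (1 : Matrix (ι₁ ⊕ ι₂) (ι₁ ⊕ ι₂) ℝ)) {k : ℕ → ℕ}
    (hk : Tendsto (fun n => ‖1 - (d n)⁻¹ • (G n).toBlocks₁₁‖ ^ (k n + 1)) atTop (𝓝 0)) (R : ℝ)
    {δ : ℝ} (hδ : 0 < δ) :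
    ∀ᶠ n : ℕ in atTop, ∀ (c : ℝ) (w : ι₁ ⊕ ι₂ → ℝ), ‖c • w‖₂ ≤ R →
      ‖c • (gradientStep (G n).toBlocks₁₁ (d n) (w ∘ Sum.inl))^[k n] (((G n)⁻¹ *ᵥ w) ∘ Sum.inl) -
        S.toBlocks₁₁⁻¹ *ᵥ ((c • w) ∘ Sum.inl)‖₂ < δ := by
  obtain ⟨K, hK⟩ := exists_eventually_isUnit_det_and_norm_inv_le hS hG
  obtain ⟨D, hD⟩ := exists_eventually_le_of_isBigO_one hd
  have rate_tendsto : Tendsto (fun n => K ^ 2 * D * √(‖1 - (d n)⁻¹ • (G n).toBlocks₁₁‖ ^ (k n + 1))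
      * R + ‖(G n).toBlocks₁₁⁻¹ - S.toBlocks₁₁⁻¹‖ * R) atTop (𝓝 0) := by
    have inv_tendsto := tendsto_iff_norm_sub_tendsto_zero.1
      (tendsto_matrix_inv (tendsto_toBlocks₁₁ hG) (det_toBlocks₁₁_ne_zero hS))
    simpa using ((hk.sqrt.const_mul (K ^ 2 * D)).mul_const R).add (inv_tendsto.mul_const R)
  filter_upwards [hd₀, hΔ, hK, hD, rate_tendsto.eventually_lt_const hδ]
    with n hd₀ hΔ ⟨⟨hdet, hK⟩, hdet₁, hK₁⟩ hD rate_lt c w hw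
  set r := (gradientStep (G n).toBlocks₁₁ (d n) (w ∘ Sum.inl))^[k n] (((G n)⁻¹ *ᵥ w) ∘ Sum.inl)
  set u := (G n).toBlocks₁₁⁻¹ *ᵥ (w ∘ Sum.inl)
  have split : c • r - S.toBlocks₁₁⁻¹ *ᵥ ((c • w) ∘ Sum.inl) = c • (r - u) +
      ((G n).toBlocks₁₁⁻¹ - S.toBlocks₁₁⁻¹) *ᵥ ((c • w) ∘ Sum.inl) := by
    have : (c • w) ∘ Sum.inl = c • (w ∘ Sum.inl : ι₁ → ℝ) := rfl
    simp only [this, u, sub_mulVec, mulVec_smul, smul_sub]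
    abel
  have hD₀ : 0 ≤ D := hd₀.le.trans hD
  set q := ‖1 - (d n)⁻¹ • (G n).toBlocks₁₁‖
  have iteration_error_le : ‖c • (r - u)‖₂ ≤ K ^ 2 * D * √(q ^ (k n + 1)) * R :=
    calc ‖c • (r - u)‖₂ = |c| * ‖r - u‖₂ := norm_smul c (WithLp.toLp 2 (r - u))
      _ ≤ |c| * (K ^ 2 * d n * √(q ^ (k n + 1)) * ‖w‖₂) := by
        gcongr
        exact norm_iterate_gradientStep_sub_le hd₀ (hG' n) hΔ hdet hdet₁ hK hK₁ w (k n)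
      _ = K ^ 2 * d n * √(q ^ (k n + 1)) * ‖c • w‖₂ := by
        rw [WithLp.toLp_smul, norm_smul, Real.norm_eq_abs]
        ring
      _ ≤ K ^ 2 * D * √(q ^ (k n + 1)) * R := by gcongr
  rw [split]
  refine (norm_add_le (WithLp.toLp 2 _) (WithLp.toLp 2 _)).trans_lt <|
    (add_le_add iteration_error_le ((norm_toLp_mulVec_le _ _).trans ?_)).trans_lt rate_lt
  gcongr
  exact (norm_toLp_comp_le Sum.inl_injective _).trans hw

end Asymptotics

section ConvergenceInDistribution

variable {ι E Ω' Ω'₂ : Type*} {Ω Ω₂ : ι → Type*} {l : Filter ι}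
  [∀ i, MeasurableSpace (Ω i)] [∀ i, MeasurableSpace (Ω₂ i)]
  [MeasurableSpace Ω'] [MeasurableSpace Ω'₂]
  {P : ∀ i, Measure (Ω i)} [∀ i, IsProbabilityMeasure (P i)]
  {P₂ : ∀ i, Measure (Ω₂ i)} [∀ i, IsProbabilityMeasure (P₂ i)]
  {Q : Measure Ω'} [IsProbabilityMeasure Q] {Q₂ : Measure Ω'₂} [IsProbabilityMeasure Q₂]
  [MeasurableSpace E] {U : ∀ i, Ω i → E} {Z : Ω' → E}

theorem tendstoInDistribution_of_map_eq [TopologicalSpace E] [OpensMeasurableSpace E]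
    {U₂ : ∀ i, Ω₂ i → E} {Z₂ : Ω'₂ → E} (h : TendstoInDistribution U l Z P Q)
    (hU₂ : ∀ i, AEMeasurable (U₂ i) (P₂ i)) (hZ₂ : AEMeasurable Z₂ Q₂)
    (hU : ∀ i, (P₂ i).map (U₂ i) = (P i).map (U i)) (hZ : Q₂.map Z₂ = Q.map Z) :
    TendstoInDistribution U₂ l Z₂ P₂ Q₂ := by
  refine ⟨hU₂, hZ₂, ?_⟩
  simp only [hU, hZ]
  exact h.tendsto

/-- Slutsky's lemma. Mathlib has it for a single probability space; the laws do not change when all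
variables are lifted to the product of the spaces `Ω i`. -/
theorem tendstoInDistribution_of_tendsto_measure_norm_sub [NormedAddCommGroup E]
    [SecondCountableTopology E] [BorelSpace E] [l.IsCountablyGenerated] {V : ∀ i, Ω i → E}
    (hU : TendstoInDistribution U l Z P Q) (hV : ∀ i, AEMeasurable (V i) (P i))
    (hUV : ∀ δ : ℝ, 0 < δ → Tendsto (fun i => P i {ω | δ ≤ ‖V i ω - U i ω‖}) l (𝓝 0)) :
    TendstoInDistribution V l Z P Q := by
  have hπ : ∀ i, MeasurePreserving (Function.eval i) (Measure.infinitePi P) (P i) :=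
    measurePreserving_eval_infinitePi P
  have lift_aemeasurable : ∀ {T : ∀ i, Ω i → E}, (∀ i, AEMeasurable (T i) (P i)) →
      ∀ i, AEMeasurable (T i ∘ Function.eval i) (Measure.infinitePi P) := fun hT i =>
    (hT i).comp_quasiMeasurePreserving (hπ i).quasiMeasurePreserving
  have map_lift : ∀ {T : ∀ i, Ω i → E}, (∀ i, AEMeasurable (T i) (P i)) →
      ∀ i, (Measure.infinitePi P).map (T i ∘ Function.eval i) = (P i).map (T i) := fun hT i => by
    rw [← AEMeasurable.map_map_of_aemeasurable ((hπ i).map_eq.symm ▸ hT i) (hπ i).aemeasurable,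
      (hπ i).map_eq]
  have hU' := hU.forall_aemeasurable
  have lifted : TendstoInDistribution (fun i => V i ∘ Function.eval i) l Z
      (fun _ => Measure.infinitePi P) Q := by
    refine tendstoInDistribution_of_tendstoInMeasure_sub _ _
      (tendstoInDistribution_of_map_eq hU (lift_aemeasurable hU') hU.aemeasurable_limit
        (map_lift hU') rfl) ?_ (lift_aemeasurable hV)
    refine tendstoInMeasure_iff_norm.2 fun δ hδ => (hUV δ hδ).congr fun i => ?_
    have hs : NullMeasurableSet {ω | δ ≤ ‖V i ω - U i ω‖} (P i) :=
      nullMeasurableSet_le aemeasurable_const ((hV i).sub (hU' i)).norm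
    simp [← (hπ i).measure_preimage hs]
  exact tendstoInDistribution_of_map_eq lifted hV hU.aemeasurable_limit
    (fun i => (map_lift hV i).symm) rfl

end ConvergenceInDistribution

section Tightness

variable {E F Ω' : Type*} {Ω : ℕ → Type*} [∀ n, MeasurableSpace (Ω n)] [MeasurableSpace Ω']
  {P : ∀ n, Measure (Ω n)} [∀ n, IsProbabilityMeasure (P n)]
  {Q : Measure Ω'} [IsProbabilityMeasure Q]
  [NormedAddCommGroup E] [InnerProductSpace ℝ E] [FiniteDimensional ℝ E] [MeasurableSpace E]
  [BorelSpace E] {W : ∀ n, Ω n → E} {Z : Ω' → E}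

theorem tendsto_iSup_measure_lt_norm (hW : TendstoInDistribution W atTop Z P Q) :
    Tendsto (fun R : ℝ => ⨆ n, P n {ω | R < ‖W n ω‖}) atTop (𝓝 0) := by
  have hW' := hW.forall_aemeasurable
  have hP : ∀ n, IsProbabilityMeasure ((P n).map (W n)) :=
    fun n => Measure.isProbabilityMeasure_map (hW' n)
  have : IsProbabilityMeasure (Q.map Z) := Measure.isProbabilityMeasure_map hW.aemeasurable_limit
  have tight : IsTightMeasureSet (Set.range fun n => (P n).map (W n)) :=
    isTightMeasureSet_of_tendsto_charFun (f := charFun (Q.map Z)) (by fun_prop)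
      (ProbabilityMeasure.tendsto_iff_tendsto_charFun.1 hW.tendsto)
  refine (isTightMeasureSet_iff_tendsto_measure_norm_gt.1 tight).congr fun R => ?_
  rw [iSup_range]
  exact iSup_congr fun n => Measure.map_apply_of_aemeasurable (hW' n)
    (measurableSet_lt measurable_const measurable_norm)

theorem tendsto_measure_zero_of_eventually_lt_norm (hW : TendstoInDistribution W atTop Z P Q)
    {A : ∀ n, Set (Ω n)} (hA : ∀ R, ∀ᶠ n in atTop, ∀ ω ∈ A n, R < ‖W n ω‖) :
    Tendsto (fun n => P n (A n)) atTop (𝓝 0) := by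
  refine ENNReal.tendsto_nhds_zero.2 fun δ hδ => ?_
  obtain ⟨R, hR⟩ :=
    (ENNReal.tendsto_nhds_zero.1 (tendsto_iSup_measure_lt_norm hW) δ hδ).exists
  filter_upwards [hA R] with n hn
  exact (measure_mono (hn ·)).trans ((le_iSup (fun n => P n {ω | R < ‖W n ω‖}) n).trans hR)

theorem tendsto_measure_one_of_eventually_norm_le (hW : TendstoInDistribution W atTop Z P Q)
    {A : ∀ n, Set (Ω n)} (hA : ∀ R, ∀ᶠ n in atTop, ∀ ω, ‖W n ω‖ ≤ R → ω ∈ A n) :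
    Tendsto (fun n => P n (A n)) atTop (𝓝 1) := by
  have compl_tendsto : Tendsto (fun n => P n (A n)ᶜ) atTop (𝓝 0) :=
    tendsto_measure_zero_of_eventually_lt_norm hW fun R => (hA R).mono fun n hn ω hω =>
      not_le.1 fun hle => hω (hn ω hle)
  have one_sub := ENNReal.Tendsto.sub (tendsto_const_nhds (x := 1)) compl_tendsto
    (Or.inl ENNReal.one_ne_top)
  rw [tsub_zero] at one_sub
  refine tendsto_of_tendsto_of_tendsto_of_le_of_le one_sub tendsto_const_nhds (fun n => ?_)
    fun _ => prob_le_one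
  rw [tsub_le_iff_right, ← measure_univ (μ := P n), ← Set.union_compl_self (A n)]
  exact measure_union_le _ _

theorem tendstoInDistribution_of_eventually_norm_sub_lt [NormedAddCommGroup F]
    [SecondCountableTopology F] [MeasurableSpace F] [BorelSpace F] {V : ∀ n, Ω n → F} {T : E → F}
    (hW : TendstoInDistribution W atTop Z P Q) (hT : Continuous T)
    (hV : ∀ n, AEMeasurable (V n) (P n))
    (h : ∀ R δ, 0 < δ → ∀ᶠ n in atTop, ∀ ω, ‖W n ω‖ ≤ R → ‖V n ω - T (W n ω)‖ < δ) :
    TendstoInDistribution V atTop (T ∘ Z) P Q :=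
  tendstoInDistribution_of_tendsto_measure_norm_sub (hW.continuous_comp hT) hV fun δ hδ =>
    tendsto_measure_zero_of_eventually_lt_norm hW fun R => (h R δ hδ).mono fun _ hn ω hω =>
      not_le.1 fun hle => (hn ω hle).not_ge hω

end Tightness

section Gaussian

variable {ι κ : Type*} [Fintype ι] [DecidableEq ι] [Fintype κ] [DecidableEq κ]

theorem map_mulVec_multivariateGaussian {C : Matrix κ κ ℝ} (hC : C.PosSemidef)
    (μ : EuclideanSpace ℝ κ) (B : Matrix ι κ ℝ) :
    (multivariateGaussian μ C).map (fun x => WithLp.toLp 2 (B *ᵥ x.ofLp)) =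
      multivariateGaussian (WithLp.toLp 2 (B *ᵥ μ.ofLp)) (B * C * Bᵀ) := by
  have hBCB : (B * C * Bᵀ).PosSemidef := by
    simpa using hC.mul_mul_conjTranspose_same B
  have hB : Continuous fun x : EuclideanSpace ℝ κ => WithLp.toLp 2 (B *ᵥ x.ofLp) := by fun_prop
  have : IsProbabilityMeasure
      ((multivariateGaussian μ C).map fun x => WithLp.toLp 2 (B *ᵥ x.ofLp)) :=
    Measure.isProbabilityMeasure_map hB.aemeasurable
  refine Measure.ext_of_charFun (funext fun t => ?_)
  have adjoint (x : EuclideanSpace ℝ κ) :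
      inner ℝ (WithLp.toLp 2 (B *ᵥ x.ofLp)) t = inner ℝ x (WithLp.toLp 2 (Bᵀ *ᵥ t.ofLp)) := by
    simp [EuclideanSpace.inner_eq_star_dotProduct, dotProduct_mulVec, vecMul_transpose,
      dotProduct_comm]
  have charFun_map : charFun ((multivariateGaussian μ C).map fun x => WithLp.toLp 2 (B *ᵥ x.ofLp)) t
      = charFun (multivariateGaussian μ C) (WithLp.toLp 2 (Bᵀ *ᵥ t.ofLp)) := by
    rw [charFun_apply, charFun_apply, integral_map hB.aemeasurable (by fun_prop)]
    simp only [adjoint]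
  have quadratic : (Bᵀ *ᵥ t.ofLp) ⬝ᵥ C *ᵥ (Bᵀ *ᵥ t.ofLp) = t.ofLp ⬝ᵥ (B * C * Bᵀ) *ᵥ t.ofLp := by
    rw [← mulVec_mulVec, ← mulVec_mulVec, dotProduct_mulVec t.ofLp B, ← mulVec_transpose]
  rw [charFun_map, charFun_multivariateGaussian hC, charFun_multivariateGaussian hBCB, quadratic,
    real_inner_comm, ← adjoint, real_inner_comm]

theorem tendstoInDistribution_multivariateGaussian {Ω : ℕ → Type*} [∀ n, MeasurableSpace (Ω n)]
    {P : ∀ n, Measure (Ω n)} [∀ n, IsProbabilityMeasure (P n)] {U : ∀ n, Ω n → EuclideanSpace ℝ ι}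
    {μ : EuclideanSpace ℝ ι} {C : ℕ → Matrix ι ι ℝ} {C₀ : Matrix ι ι ℝ}
    (hU : ∀ n, HasLaw (U n) (multivariateGaussian μ (C n)) (P n))
    (hC : ∀ n, (C n).PosSemidef) (hC₀ : C₀.PosSemidef) (h : Tendsto C atTop (𝓝 C₀)) :
    TendstoInDistribution U atTop (id : EuclideanSpace ℝ ι → EuclideanSpace ℝ ι) P
      (multivariateGaussian μ C₀) := by
  refine ⟨fun n => (hU n).aemeasurable, aemeasurable_id, ?_⟩
  refine ProbabilityMeasure.tendsto_iff_tendsto_charFun.2 fun t => ?_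
  simp only [ProbabilityMeasure.coe_mk, Measure.map_id, (hU _).map_eq,
    charFun_multivariateGaussian (hC _), charFun_multivariateGaussian hC₀]
  have continuous_exponent : Continuous fun M : Matrix ι ι ℝ =>
      Complex.exp (inner ℝ t μ * Complex.I - (t.ofLp ⬝ᵥ M *ᵥ t.ofLp : ℝ) / 2) := by fun_prop
  exact (continuous_exponent.tendsto C₀).comp h

end Gaussian

section OracleProperty

variable {p₁ p₂ : ℕ} {Ω : ℕ → Type*} [∀ n, MeasurableSpace (Ω n)]
  {P : ∀ n, Measure (Ω n)} [∀ n, IsProbabilityMeasure (P n)] {σ : ℝ}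
  {S : Matrix (Fin p₁ ⊕ Fin p₂) (Fin p₁ ⊕ Fin p₂) ℝ} {β : Fin p₁ ⊕ Fin p₂ → ℝ}

theorem tendstoInDistribution_score {ι : Type*} [Fintype ι] [DecidableEq ι]
    {X : ∀ n, Matrix (Fin n) ι ℝ} {S : Matrix ι ι ℝ} (hS : S.PosSemidef)
    (hX : Tendsto (fun n => normGram (X n)) atTop (𝓝 S))
    {ε : ∀ n, Ω n → EuclideanSpace ℝ (Fin n)}
    (hε : ∀ n, HasLaw (ε n)
      (multivariateGaussian 0 (σ ^ 2 • (1 : Matrix (Fin n) (Fin n) ℝ))) (P n)) :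
    TendstoInDistribution
      (fun (n : ℕ) ω => √(n : ℝ) • WithLp.toLp 2 (scaledScore (X n) (ε n ω).ofLp))
      atTop (id : EuclideanSpace ℝ ι → EuclideanSpace ℝ ι) P
      (multivariateGaussian 0 (σ ^ 2 • S)) := by
  refine tendstoInDistribution_multivariateGaussian (C := fun n => σ ^ 2 • normGram (X n))
    (fun n => ?_) (fun n => (posSemidef_normGram _).smul (sq_nonneg σ))
    (hS.smul (sq_nonneg σ)) (hX.const_smul _)
  set B := (√(n : ℝ))⁻¹ • (X n)ᵀ with hB
  have score_eq (e : Fin n → ℝ) :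
      √(n : ℝ) • WithLp.toLp 2 (scaledScore (X n) e) = WithLp.toLp 2 (B *ᵥ e) := by
    rw [scaledScore, hB, smul_mulVec, ← WithLp.toLp_smul, smul_smul, ← div_eq_mul_inv,
      Real.sqrt_div_self', one_div]
  have covariance_eq : B * (σ ^ 2 • (1 : Matrix (Fin n) (Fin n) ℝ)) * Bᵀ =
      σ ^ 2 • normGram (X n) := by
    rw [hB, normGram, Matrix.mul_smul, Matrix.mul_one, transpose_smul, transpose_transpose]
    simp only [smul_mul, Matrix.mul_smul, smul_smul]
    rw [mul_left_comm, ← mul_inv, Real.mul_self_sqrt (Nat.cast_nonneg n)]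
  have hB' : Continuous fun x : EuclideanSpace ℝ (Fin n) => WithLp.toLp 2 (B *ᵥ x.ofLp) := by
    fun_prop
  have law := map_mulVec_multivariateGaussian
    (PosSemidef.one.smul (sq_nonneg σ) : (σ ^ 2 • (1 : Matrix (Fin n) (Fin n) ℝ)).PosSemidef) 0 B
  rw [covariance_eq, WithLp.ofLp_zero, mulVec_zero, WithLp.toLp_zero] at law
  simp only [score_eq]
  have law' : HasLaw (fun x : EuclideanSpace ℝ (Fin n) => WithLp.toLp 2 (B *ᵥ x.ofLp))
      (multivariateGaussian 0 (σ ^ 2 • normGram (X n)))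
      (multivariateGaussian 0 (σ ^ 2 • (1 : Matrix (Fin n) (Fin n) ℝ))) := ⟨hB'.aemeasurable, law⟩
  exact law'.comp (hε n)

theorem map_toBlocks₁₁_inv_mulVec_multivariateGaussian (hS : S.PosDef) :
    (multivariateGaussian 0 (σ ^ 2 • S)).map
      (fun x => WithLp.toLp 2 (S.toBlocks₁₁⁻¹ *ᵥ (x.ofLp ∘ Sum.inl))) =
        multivariateGaussian 0 (σ ^ 2 • S.toBlocks₁₁⁻¹) := by
  set B := fromCols S.toBlocks₁₁⁻¹ (0 : Matrix (Fin p₁) (Fin p₂) ℝ) with hB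
  have hS₁ : S.toBlocks₁₁.PosDef := hS.submatrix Sum.inl_injective
  have symm : S.toBlocks₁₁⁻¹ᵀ = S.toBlocks₁₁⁻¹ := by simpa using hS₁.inv.isHermitian.eq
  have covariance_eq : B * (σ ^ 2 • S) * Bᵀ = σ ^ 2 • S.toBlocks₁₁⁻¹ := by
    rw [Matrix.mul_smul, smul_mul, ← fromBlocks_toBlocks S, hB, fromCols_mul_fromBlocks,
      transpose_fromCols, fromCols_mul_fromRows, symm, fromBlocks_toBlocks]
    simp [nonsing_inv_mul _ hS₁.det_pos.ne'.isUnit]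
  have mulVec_eq (x : Fin p₁ ⊕ Fin p₂ → ℝ) : B *ᵥ x = S.toBlocks₁₁⁻¹ *ᵥ (x ∘ Sum.inl) := by
    rw [hB, fromCols_mulVec]
    simp
  have law := map_mulVec_multivariateGaussian (hS.posSemidef.smul (sq_nonneg σ)) 0 B
  rw [covariance_eq, WithLp.ofLp_zero, mulVec_zero, WithLp.toLp_zero] at law
  simpa only [mulVec_eq] using law

theorem oracleProperty_of_eventually {W : ∀ n, Ω n → EuclideanSpace ℝ (Fin p₁ ⊕ Fin p₂)}
    (hS : S.PosDef)
    (hW : TendstoInDistribution W atTop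
      (id : EuclideanSpace ℝ (Fin p₁ ⊕ Fin p₂) → EuclideanSpace ℝ (Fin p₁ ⊕ Fin p₂)) P
      (multivariateGaussian 0 (σ ^ 2 • S)))
    {b : ∀ n, Ω n → Fin p₁ ⊕ Fin p₂ → ℝ} (hb : ∀ n, AEMeasurable (b n) (P n))
    (h₂ : ∀ R, ∀ᶠ n in atTop, ∀ ω, ‖W n ω‖ ≤ R → ∀ j, b n ω (Sum.inr j) = 0)
    (h₁ : ∀ R δ, 0 < δ → ∀ᶠ n : ℕ in atTop, ∀ ω, ‖W n ω‖ ≤ R →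
      ‖√(n : ℝ) • (fun j => b n ω (Sum.inl j) - β (Sum.inl j)) -
        S.toBlocks₁₁⁻¹ *ᵥ ((W n ω).ofLp ∘ Sum.inl)‖₂ < δ) :
    OracleProperty P S σ β b := by
  refine ⟨tendsto_measure_one_of_eventually_norm_le hW h₂, ?_⟩
  have hT : Continuous fun x : EuclideanSpace ℝ (Fin p₁ ⊕ Fin p₂) =>
      WithLp.toLp 2 (S.toBlocks₁₁⁻¹ *ᵥ (x.ofLp ∘ Sum.inl)) := by
    simp only [Function.comp_def]
    fun_prop
  have hV (n : ℕ) : Continuous fun x : Fin p₁ ⊕ Fin p₂ → ℝ =>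
      √(n : ℝ) • WithLp.toLp 2 (fun j : Fin p₁ => x (Sum.inl j) - β (Sum.inl j)) := by fun_prop
  have limit := tendstoInDistribution_of_eventually_norm_sub_lt hW hT
    (fun n => (hV n).measurable.comp_aemeasurable (hb n)) h₁
  refine tendstoInDistribution_of_map_eq limit limit.forall_aemeasurable aemeasurable_id
    (fun _ => rfl) ?_
  rw [Measure.map_id, Function.comp_id, map_toBlocks₁₁_inv_mulVec_multivariateGaussian hS]

theorem oracleProperty_of_isEmpty [IsEmpty (Fin p₁ ⊕ Fin p₂)] (hS : S.PosDef)
    {W : ∀ n, Ω n → EuclideanSpace ℝ (Fin p₁ ⊕ Fin p₂)}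
    (hW : TendstoInDistribution W atTop
      (id : EuclideanSpace ℝ (Fin p₁ ⊕ Fin p₂) → EuclideanSpace ℝ (Fin p₁ ⊕ Fin p₂)) P
      (multivariateGaussian 0 (σ ^ 2 • S)))
    (b : ∀ n, Ω n → Fin p₁ ⊕ Fin p₂ → ℝ) : OracleProperty P S σ β b := by
  have : IsEmpty (Fin p₁) := ⟨fun j => isEmptyElim (Sum.inl j : Fin p₁ ⊕ Fin p₂)⟩
  refine oracleProperty_of_eventually hS hW
    (fun n => (measurable_of_subsingleton_codomain (b n)).aemeasurable)
    (fun R => .of_forall fun n ω _ j => isEmptyElim (Sum.inr j : Fin p₁ ⊕ Fin p₂))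
    fun R δ hδ => .of_forall fun n ω _ => ?_
  rwa [Subsingleton.elim (WithLp.toLp 2 _) 0, norm_zero]

open scoped Matrix.Norms.L2Operator

theorem oracleProperty_oemSeq {X : ∀ n, Matrix (Fin n) (Fin p₁ ⊕ Fin p₂) ℝ} {m : ℕ → ℕ}
    {Δ : ∀ n, Matrix (Fin (m n)) (Fin p₁ ⊕ Fin p₂) ℝ} {d L M : ℕ → ℝ} {s : ℕ → ℝ → ℝ}
    {ε : ∀ n, Ω n → EuclideanSpace ℝ (Fin n)} (hε : ∀ n, AEMeasurable (ε n) (P n))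
    (hW : TendstoInDistribution
      (fun (n : ℕ) ω => √(n : ℝ) • WithLp.toLp 2 (scaledScore (X n) (ε n ω).ofLp))
      atTop (id : EuclideanSpace ℝ (Fin p₁ ⊕ Fin p₂) → EuclideanSpace ℝ (Fin p₁ ⊕ Fin p₂)) P
      (multivariateGaussian 0 (σ ^ 2 • S)))
    (hs : ∀ n, Measurable (s n)) (hs' : ∀ᶠ n in atTop, IsThresholdingRule (s n) (L n) (M n) (d n))
    (hL : Tendsto (fun n : ℕ => √(n : ℝ) * L n) atTop atTop) (hM : Tendsto M atTop (𝓝 0))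
    (hS : S.PosDef) (hX : Tendsto (fun n => normGram (X n)) atTop (𝓝 S))
    (hd₀ : ∀ᶠ n in atTop, 0 < d n) (hd : d =O[atTop] fun _ => (1 : ℝ))
    (hΔ : ∀ᶠ n in atTop, normGram (X n) + (Δ n)ᵀ * Δ n =
      d n • (1 : Matrix (Fin p₁ ⊕ Fin p₂) (Fin p₁ ⊕ Fin p₂) ℝ))
    (hβ₁ : ∀ j, β (Sum.inl j) ≠ 0) (hβ₂ : ∀ j, β (Sum.inr j) = 0) {k : ℕ → ℕ}
    (hk : Tendsto (fun n => ‖1 - (d n)⁻¹ • (normGram (X n)).toBlocks₁₁‖ ^ k n) atTop (𝓝 0)) :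
    OracleProperty P S σ β (fun n ω =>
      oemSeq (s n) (X n) (Δ n) (X n *ᵥ β + (ε n ω).ofLp) (k n)) := by
  have eventually_ne_zero : ∀ᶠ n in atTop, k n ≠ 0 :=
    (hk.eventually_lt_const one_pos).mono fun n hn h => by simp [h] at hn
  have hk' : Tendsto (fun n => ‖1 - (d n)⁻¹ • (normGram (X n)).toBlocks₁₁‖ ^ (k n - 1 + 1)) atTop
      (𝓝 0) := by
    refine hk.congr' ?_
    filter_upwards [eventually_ne_zero] with n hn
    rw [Nat.sub_one_add_one hn]
  have hb (n : ℕ) : AEMeasurable (fun ω =>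
      oemSeq (s n) (X n) (Δ n) (X n *ᵥ β + (ε n ω).ofLp) (k n)) (P n) := by
    have hY : Continuous fun x : EuclideanSpace ℝ (Fin n) => X n *ᵥ β + x.ofLp := by fun_prop
    exact ((measurable_oemSeq (hs n) (X n) (Δ n) (k n)).comp hY.measurable).comp_aemeasurable (hε n)
  have oemSeq_eq (R : ℝ) : ∀ᶠ n : ℕ in atTop, ∀ ω,
      ‖√(n : ℝ) • WithLp.toLp 2 (scaledScore (X n) (ε n ω).ofLp)‖ ≤ R →
      oemSeq (s n) (X n) (Δ n) (X n *ᵥ β + (ε n ω).ofLp) (k n) =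
        β + Sum.elim ((gradientStep (normGram (X n)).toBlocks₁₁ (d n)
          (scaledScore (X n) (ε n ω).ofLp ∘ Sum.inl))^[k n - 1]
            (((normGram (X n))⁻¹ *ᵥ scaledScore (X n) (ε n ω).ofLp) ∘ Sum.inl)) 0 := by
    filter_upwards [eventually_ne_zero,
      eventually_oemSeq_succ_eq hs' hL hM hS hX hd₀ hd hΔ hβ₁ hβ₂ R] with n hn heq ω hω
    rw [norm_smul, Real.norm_of_nonneg (Real.sqrt_nonneg _)] at hω
    rw [← heq _ hω, Nat.sub_one_add_one hn]
  refine oracleProperty_of_eventually hS hW hb (fun R => ?_) fun R δ hδ => ?_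
  · filter_upwards [oemSeq_eq R] with n heq ω hω j
    simp [heq ω hω, hβ₂]
  · filter_upwards [oemSeq_eq R, eventually_norm_smul_iterate_gradientStep_sub_lt hS hX
      (fun n => posSemidef_normGram (X n)) hd₀ hd hΔ hk' R hδ] with n heq hlt ω hω
    simpa [heq ω hω] using hlt _ _ hω

end OracleProperty

theorem one_le_of_add_transpose_mul_self {ι κ : Type*} [DecidableEq ι] [Fintype κ]
    {G : Matrix ι ι ℝ} {Δ : Matrix κ ι ℝ} {d : ℝ} {j : ι} (hG : G j j = 1)
    (h : G + Δᵀ * Δ = d • (1 : Matrix ι ι ℝ)) : 1 ≤ d := by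
  have diag : 1 + ∑ i, Δ i j * Δ i j = d := by
    simpa [hG, mul_apply] using congr_fun₂ h j j
  linarith [Finset.sum_nonneg fun i (_ : i ∈ Finset.univ) => mul_self_nonneg (Δ i j)]

open scoped Matrix.Norms.L2Operator in
theorem tendsto_norm_pow_of_maxEigenvalue {α ι₁ ι₂ : Type*} [Fintype ι₁] [DecidableEq ι₁]
    [DecidableEq ι₂] {l : Filter α} {m k : α → ℕ} {G : α → Matrix (ι₁ ⊕ ι₂) (ι₁ ⊕ ι₂) ℝ}
    {Δ : ∀ a, Matrix (Fin (m a)) (ι₁ ⊕ ι₂) ℝ} {d : α → ℝ} (hd : ∀ᶠ a in l, 0 < d a)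
    (hΔ : ∀ᶠ a in l, G a + (Δ a)ᵀ * Δ a = d a • (1 : Matrix (ι₁ ⊕ ι₂) (ι₁ ⊕ ι₂) ℝ))
    (hk : Tendsto (fun a => maxEigenvalue
      ((1 : Matrix ι₁ ι₁ ℝ) - (d a)⁻¹ • (G a).toBlocks₁₁) ^ k a) l (𝓝 0)) :
    Tendsto (fun a => ‖1 - (d a)⁻¹ • (G a).toBlocks₁₁‖ ^ k a) l (𝓝 0) := by
  refine squeeze_zero' (.of_forall fun a => by positivity) ?_ hk
  filter_upwards [hd, hΔ] with a hda hΔa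
  gcongr
  exact norm_le_maxEigenvalue (posSemidef_one_sub_toBlocks₁₁ hda hΔa)

theorem tendsto_zero_of_mul_div {ι : Type*} {l : Filter ι} {f u v : ι → ℝ}
    (hf : Tendsto (fun i => f i * u i / v i) l (𝓝 0))
    (h : Tendsto (fun i => u i / v i) l atTop) : Tendsto f l (𝓝 0) := by
  refine (hf.div_atTop h).congr' ?_
  filter_upwards [h.eventually_gt_atTop 0] with i hi
  rw [mul_div_assoc, mul_div_cancel_right₀ _ hi.ne']

theorem theorem1_general {p₁ p₂ : ℕ} {Ω : ℕ → Type*} [∀ n, MeasurableSpace (Ω n)]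
    (P : ∀ n, Measure (Ω n)) [∀ n, IsProbabilityMeasure (P n)] (σ : ℝ)
    (ε : ∀ n, Ω n → EuclideanSpace ℝ (Fin n)) (hε : ∀ n, AEMeasurable (ε n) (P n))
    (β : Fin p₁ ⊕ Fin p₂ → ℝ)
    (hβ₁ : ∀ j, β (Sum.inl j) ≠ 0) (hβ₂ : ∀ j, β (Sum.inr j) = 0)
    (X : ∀ n, Matrix (Fin n) (Fin p₁ ⊕ Fin p₂) ℝ)
    (S : Matrix (Fin p₁ ⊕ Fin p₂) (Fin p₁ ⊕ Fin p₂) ℝ) (hS : S.PosDef)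
    (hX : Tendsto (fun n => normGram (X n)) atTop (𝓝 S))
    (hdiag : ∀ n, 1 ≤ n → ∀ j, normGram (X n) j j = 1)
    (hW : TendstoInDistribution
      (fun (n : ℕ) ω => √(n : ℝ) • WithLp.toLp 2 (scaledScore (X n) (ε n ω).ofLp))
      atTop (id : EuclideanSpace ℝ (Fin p₁ ⊕ Fin p₂) → EuclideanSpace ℝ (Fin p₁ ⊕ Fin p₂)) P
      (multivariateGaussian 0 (σ ^ 2 • S)))
    (m : ℕ → ℕ) (Δ : ∀ n, Matrix (Fin (m n)) (Fin p₁ ⊕ Fin p₂) ℝ) (d : ℕ → ℝ)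
    (hΔ : ∀ n, 1 ≤ n → normGram (X n) + (Δ n)ᵀ * Δ n =
      d n • (1 : Matrix (Fin p₁ ⊕ Fin p₂) (Fin p₁ ⊕ Fin p₂) ℝ))
    (hd : d =O[atTop] fun _ => (1 : ℝ))
    (lam : ℕ → ℝ)
    (hlam₁ : Tendsto (fun n : ℕ => lam n / n) atTop (𝓝 0))
    (hlam₂ : Tendsto (fun n : ℕ => lam n / √(n : ℝ)) atTop atTop)
    (k : ℕ → ℕ)
    (hk : Tendsto (fun n : ℕ => maxEigenvalue
      ((1 : Matrix (Fin p₁) (Fin p₁) ℝ) - (d n)⁻¹ • (normGram (X n)).toBlocks₁₁) ^ k n)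
      atTop (𝓝 0)) :
    (∀ a : ℝ, 2 < a → OracleProperty P S σ β (fun n ω =>
      oemSeq (scadUpdate a (lam n / n) (d n)) (X n) (Δ n) (X n *ᵥ β + (ε n ω).ofLp) (k n))) ∧
    (∀ a : ℝ, 1 < a → OracleProperty P S σ β (fun n ω =>
      oemSeq (mcpUpdate a (lam n / n) (d n)) (X n) (Δ n) (X n *ᵥ β + (ε n ω).ofLp) (k n))) := by
  rcases isEmpty_or_nonempty (Fin p₁ ⊕ Fin p₂) with _ | ⟨⟨j⟩⟩
  · exact ⟨fun a _ => oracleProperty_of_isEmpty hS hW _,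
      fun a _ => oracleProperty_of_isEmpty hS hW _⟩
  have hd₁ : ∀ᶠ n in atTop, 1 ≤ d n := (eventually_ge_atTop 1).mono fun n hn =>
    one_le_of_add_transpose_mul_self (hdiag n hn j) (hΔ n hn)
  have hd₀ : ∀ᶠ n in atTop, 0 < d n := hd₁.mono fun n hn => one_pos.trans_le hn
  have hΔ' := (eventually_ge_atTop 1).mono hΔ
  have hL : Tendsto (fun n : ℕ => √(n : ℝ) * (lam n / n)) atTop atTop :=
    hlam₂.congr fun n => by rw [mul_div_left_comm, Real.sqrt_div_self', mul_one_div]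
  have hL₀ : ∀ᶠ n : ℕ in atTop, 0 ≤ lam n / n :=
    (hL.eventually_gt_atTop 0).mono fun n hn => (pos_of_mul_pos_right hn (Real.sqrt_nonneg _)).le
  have hM (a : ℝ) : Tendsto (fun n : ℕ => a * (lam n / n)) atTop (𝓝 0) := by
    simpa using hlam₁.const_mul a
  have oracle (a : ℝ) {s : ℕ → ℝ → ℝ} (hs : ∀ n, Measurable (s n))
      (hs' : ∀ᶠ n in atTop, IsThresholdingRule (s n) (lam n / n) (a * (lam n / n)) (d n)) :=
    oracleProperty_oemSeq hε hW hs hs' hL (hM a) hS hX hd₀ hd hΔ' hβ₁ hβ₂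
      (tendsto_norm_pow_of_maxEigenvalue hd₀ hΔ' hk)
  refine ⟨fun a ha => oracle a (fun n => measurable_scadUpdate _ _ _) ?_,
    fun a ha => oracle a (fun n => measurable_mcpUpdate _ _ _) ?_⟩
  · filter_upwards [hL₀, hd₁] with n hLn hdn using isThresholdingRule_scadUpdate ha.le hLn hdn
  · filter_upwards [hL₀, hd₁] with n hLn hdn using isThresholdingRule_mcpUpdate ha.le hLn hdn

theorem theorem1 {p₁ p₂ : ℕ}
    -- For each sample size, a probability space with the Gaussian error vector.
    {Ω : ℕ → Type*} [∀ n, MeasurableSpace (Ω n)]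
    (P : ∀ n, Measure (Ω n)) [∀ n, IsProbabilityMeasure (P n)]
    (σ : ℝ) (hσ : 0 < σ)
    (ε : ∀ n, Ω n → EuclideanSpace ℝ (Fin n))
    (hε : ∀ n, HasLaw (ε n)
      (multivariateGaussian 0 (σ ^ 2 • (1 : Matrix (Fin n) (Fin n) ℝ))) (P n))
    -- The true coefficients.
    (β : Fin p₁ ⊕ Fin p₂ → ℝ)
    (hβ₁ : ∀ j, β (Sum.inl j) ≠ 0) (hβ₂ : ∀ j, β (Sum.inr j) = 0)
    -- The regression matrices, their limiting Gram matrix, and the orthogonal completion.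
    (X : ∀ n, Matrix (Fin n) (Fin p₁ ⊕ Fin p₂) ℝ)
    (S : Matrix (Fin p₁ ⊕ Fin p₂) (Fin p₁ ⊕ Fin p₂) ℝ) (hS : S.PosDef)
    (hX : Tendsto (fun n => normGram (X n)) atTop (𝓝 S))
    (hdiag : ∀ n, 1 ≤ n → ∀ j, normGram (X n) j j = 1)
    (m : ℕ → ℕ) (Δ : ∀ n, Matrix (Fin (m n)) (Fin p₁ ⊕ Fin p₂) ℝ)
    (d : ℕ → ℝ)
    (hΔ : ∀ n, 1 ≤ n → normGram (X n) + (Δ n)ᵀ * Δ n =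
      d n • (1 : Matrix (Fin p₁ ⊕ Fin p₂) (Fin p₁ ⊕ Fin p₂) ℝ))
    (hdγ : ∀ n, 1 ≤ n → maxEigenvalue (normGram (X n)) ≤ d n)
    (hd : d =O[atTop] fun _ => (1 : ℝ))
    -- The tuning parameters.
    (lam : ℕ → ℝ)
    (hlam₁ : Tendsto (fun n : ℕ => lam n / n) atTop (𝓝 0))
    (hlam₂ : Tendsto (fun n : ℕ => lam n / √(n : ℝ)) atTop atTop)
    -- The iteration counts.
    (k : ℕ → ℕ)
    (hk₁ : Tendsto (fun n : ℕ =>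
      maxEigenvalue ((1 : Matrix (Fin p₁) (Fin p₁) ℝ) - (d n)⁻¹ • (normGram (X n)).toBlocks₁₁) ^ k n
        * lam n / √(n : ℝ)) atTop (𝓝 0))
    (hk₂ : ∀ c : ℝ, 0 < c → Tendsto (fun n : ℕ =>
      (k n : ℝ) ^ 2 * Real.exp (-c * (lam n / √(n : ℝ)) ^ 2)) atTop (𝓝 0)) :
    -- SCAD
    (∀ a : ℝ, 2 < a → OracleProperty P S σ β (fun n ω =>
      oemSeq (scadUpdate a (lam n / n) (d n)) (X n) (Δ n) (X n *ᵥ β + (ε n ω).ofLp) (k n))) ∧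
    -- MCP
    (∀ a : ℝ, 1 < a → OracleProperty P S σ β (fun n ω =>
      oemSeq (mcpUpdate a (lam n / n) (d n)) (X n) (Δ n) (X n *ᵥ β + (ε n ω).ofLp) (k n))) :=
  theorem1_general P σ ε (fun n => (hε n).aemeasurable) β hβ₁ hβ₂ X S hS hX hdiag
    (tendstoInDistribution_score hS.posSemidef hX hε) m Δ d hΔ hd lam hlam₁ hlam₂ k
    (tendsto_zero_of_mul_div hk₁ hlam₂)
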